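/- Let $L$ be a finitary first-order vocabulary, let $\mathbf K=(K,\prec_{\mathbf K})$ be an abstract elementary class (AEC) of $L$-structures, and let $LS(\mathbf K)$ be its Löwenheim–Skolem number, that is, the least cardinal $\lambda\ge |L|+\aleph_0$ such that every subset $A$ of every $M\in K$ is contained in some $N\prec_{\mathbf K}M$ with $|N|\le |A|+\lambda$. A $\mathbf K$-embedding $f:M\to N$ is an isomorphism of $M$ onto some $f[M]\prec_{\mathbf K}N$. For an interval $I$ of cardinals, say that $\mathbf K$ satisfies - $JEP(I)$ if any two $M_1,M_2\in K$ with $|M_1|,|M_2|\in I$ can be $\mathbf K$-embedded into a common $N\in K$; - $AP(I)$ if for all $M_0\prec_{\mathbf K}M_1$ and $M_0\prec_{\mathbf K}M_2$ in $K$ with $|M_0|,|M_1|,|M_2|\in I$ there are $N\in K$ and $\mathbf K$-embeddings $g_\ell:M_\ell\to N$ ($\ell=1,2$) with $g_1{\restriction}M_0=g_2{\restriction}M_0$; - $DAP(I)$ if, in the situation of $AP(I)$, $N,g_1,g_2$ can be chosen so that in addition $g_1[M_1]\cap g_2[M_2]=g_1[M_0]$. **Theorem.** Let $\kappa$ be a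 strongly compact cardinal (uncountable, regular, and such that every $\kappa$-complete proper filter on any set extends to a $\kappa$-complete ultrafilter on that set), and let $\mathbf K$ be an AEC with $LS(\mathbf K)<\kappa$. Then for every cardinal $\mu<\kappa$: 1. if $\mathbf K$ satisfies $AP([\mu,\kappa))$, then $\mathbf K$ satisfies $AP([\mu,\infty))$; 2. if $\mathbf K$ satisfies $JEP([\mu,\kappa))$, then $\mathbf K$ satisfies $JEP([\mu,\infty))$; 3. if $\mathbf K$ satisfies $DAP([\mu,\kappa))$, then $\mathbf K$ satisfies $DAP([\mu,\infty))$. In particular (with $\mu=LS(\mathbf K)$) each of $AP$, $JEP$, $DAP$ for models of size in $[LS(\mathbf K),\kappa)$ implies the same property for all models of size at least $LS(\mathbf K)$, and (with $\mu=0$) each of them for all models of size less than $\kappa$ implies the same property for all models in $K$. -/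

import Mathlib

open Cardinal
open scoped FirstOrder

universe u

/-- A class of `L`-structures together with a relation `S ≺ M` between a structure `M` and its
substructures `S`. No axioms are imposed here. -/
structure StrongClass (L : FirstOrder.Language.{u, u}) where
  /-- `M` belongs to the class. -/
  Mem : ∀ (M : Type u) [L.Structure M], Prop
  /-- `S ≺ M`: the substructure `S` is a strong substructure of `M`. -/
  Strong : ∀ {M : Type u} [L.Structure M], L.Substructure M → Prop

namespace StrongClass

variable {L : FirstOrder.Language.{u, u}} (K : StrongClass L)

/-- `S ≺ T` for two substructures of a common ambient `L`-structure `N`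
(which need not belong to the class). -/
def StrongIn {N : Type u} [L.Structure N] (S T : L.Substructure N) : Prop :=
  S ≤ T ∧ K.Strong (S.comap T.subtype.toHom)

/-- `l` is a Löwenheim–Skolem cardinal: it is at least `ℵ₀ + |L|`, and every subset `A` of a
member `M` of the class lies in some `S ≺ M` of cardinality at most `|A| + l`. -/
def IsLSCardinal (l : Cardinal.{u}) : Prop :=
  ℵ₀ ≤ l ∧ L.card ≤ l ∧
    ∀ (M : Type u) [L.Structure M], K.Mem M → ∀ A : Set M,
      ∃ S : L.Substructure M, K.Strong S ∧ A ⊆ (S : Set M) ∧ #S ≤ #A + l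

/-- `⟨S i : i < δ⟩` is a continuous `≺`-increasing chain of substructures of an ambient
`L`-structure `N` (for instance of the union of the chain). -/
structure IsContinuousChain {N : Type u} [L.Structure N] (δ : Ordinal.{u})
    (S : Ordinal.{u} → L.Substructure N) : Prop where
  mem : ∀ i < δ, K.Mem (S i)
  strong : ∀ i j, i ≤ j → j < δ → K.StrongIn (S i) (S j)
  continuous : ∀ j < δ, Order.IsSuccLimit j → S j = ⨆ i : Set.Iio j, S i

end StrongClass

/-- Abstract elementary classes in the vocabulary `L`. -/
structure AEC (L : FirstOrder.Language.{u, u}) extends StrongClass L where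
  /-- The class is closed under isomorphism. -/
  mem_of_equiv : ∀ {M N : Type u} [L.Structure M] [L.Structure N],
    (M ≃[L] N) → Mem M → Mem N
  /-- The relation `≺` is closed under isomorphism. -/
  strong_map_equiv : ∀ {M N : Type u} [L.Structure M] [L.Structure N] (e : M ≃[L] N)
    (S : L.Substructure M), Strong S → Strong (S.map e.toHom)
  /-- `≺` is a relation between members of the class. -/
  mem_of_strong : ∀ {M : Type u} [L.Structure M] (S : L.Substructure M),
    Strong S → Mem S ∧ Mem M
  /-- `≺` is reflexive on the class. -/
  strong_refl : ∀ (M : Type u) [L.Structure M], Mem M → Strong (⊤ : L.Substructure M)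
  /-- `≺` is transitive. -/
  strong_trans : ∀ {M : Type u} [L.Structure M] (S : L.Substructure M) (R : L.Substructure S),
    Strong R → Strong S → Strong (R.map S.subtype.toHom)
  /-- Coherence: if `S ≺ M`, `T ≺ M` and `S ⊆ T`, then `S ≺ T`. -/
  coherence : ∀ {M : Type u} [L.Structure M] (S T : L.Substructure M),
    S ≤ T → Strong S → Strong T → toStrongClass.StrongIn S T
  /-- The union of a continuous chain of limit length belongs to the class. -/
  chain_mem : ∀ {N : Type u} [L.Structure N] (δ : Ordinal.{u})
    (S : Ordinal.{u} → L.Substructure N), Order.IsSuccLimit δ → toStrongClass.IsContinuousChain δ S →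
      Mem (⨆ i : Set.Iio δ, S i : L.Substructure N)
  /-- Every member of a continuous chain of limit length is strong in the union. -/
  chain_strong : ∀ {N : Type u} [L.Structure N] (δ : Ordinal.{u})
    (S : Ordinal.{u} → L.Substructure N), Order.IsSuccLimit δ → toStrongClass.IsContinuousChain δ S →
      ∀ i < δ, toStrongClass.StrongIn (S i) (⨆ i : Set.Iio δ, S i)
  /-- If every member of a continuous chain of limit length is strong in `M`, then so is the
  union. -/
  chain_union_strong : ∀ {M : Type u} [L.Structure M] (δ : Ordinal.{u})
    (S : Ordinal.{u} → L.Substructure M), Order.IsSuccLimit δ → toStrongClass.IsContinuousChain δ S →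
      Mem M → (∀ i < δ, Strong (S i)) → Strong (⨆ i : Set.Iio δ, S i)
  /-- A Löwenheim–Skolem cardinal exists. -/
  exists_isLSCardinal : ∃ l : Cardinal.{u}, toStrongClass.IsLSCardinal l

namespace AEC

variable {L : FirstOrder.Language.{u, u}} (K : AEC L)

/-- The Löwenheim–Skolem number of `K`: the least Löwenheim–Skolem cardinal. -/
noncomputable def LS : Cardinal.{u} :=
  sInf {l | K.IsLSCardinal l}

/-- `f` is a `K`-embedding: an isomorphism of `M` onto a strong substructure of `N`. -/
def IsEmbedding {M N : Type u} [L.Structure M] [L.Structure N] (f : M ↪[L] N) : Prop :=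
  K.Strong f.toHom.range

/-- The joint embedding property for the members of `K` whose cardinality lies in `F`. -/
def JEP (F : Set Cardinal.{u}) : Prop :=
  ∀ (M₁ M₂ : Type u) [L.Structure M₁] [L.Structure M₂],
    K.Mem M₁ → K.Mem M₂ → #M₁ ∈ F → #M₂ ∈ F →
    ∃ (N : Type u) (_ : L.Structure N) (g₁ : M₁ ↪[L] N) (g₂ : M₂ ↪[L] N),
      K.IsEmbedding g₁ ∧ K.IsEmbedding g₂

/-- The amalgamation property for the members of `K` whose cardinality lies in `F`. The inclusions
`M₀ ≺ M₁` and `M₀ ≺ M₂` are given as `K`-embeddings. -/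
def AP (F : Set Cardinal.{u}) : Prop :=
  ∀ (M₀ M₁ M₂ : Type u) [L.Structure M₀] [L.Structure M₁] [L.Structure M₂],
    K.Mem M₀ → K.Mem M₁ → K.Mem M₂ → #M₀ ∈ F → #M₁ ∈ F → #M₂ ∈ F →
    ∀ (f₁ : M₀ ↪[L] M₁) (f₂ : M₀ ↪[L] M₂), K.IsEmbedding f₁ → K.IsEmbedding f₂ →
    ∃ (N : Type u) (_ : L.Structure N) (g₁ : M₁ ↪[L] N) (g₂ : M₂ ↪[L] N),
      K.IsEmbedding g₁ ∧ K.IsEmbedding g₂ ∧ g₁.comp f₁ = g₂.comp f₂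

/-- The disjoint amalgamation property for the members of `K` whose cardinality lies in `F`: the
images of `M₁` and `M₂` meet exactly in the image of `M₀`. -/
def DAP (F : Set Cardinal.{u}) : Prop :=
  ∀ (M₀ M₁ M₂ : Type u) [L.Structure M₀] [L.Structure M₁] [L.Structure M₂],
    K.Mem M₀ → K.Mem M₁ → K.Mem M₂ → #M₀ ∈ F → #M₁ ∈ F → #M₂ ∈ F →
    ∀ (f₁ : M₀ ↪[L] M₁) (f₂ : M₀ ↪[L] M₂), K.IsEmbedding f₁ → K.IsEmbedding f₂ →
    ∃ (N : Type u) (_ : L.Structure N) (g₁ : M₁ ↪[L] N) (g₂ : M₂ ↪[L] N),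
      K.IsEmbedding g₁ ∧ K.IsEmbedding g₂ ∧ g₁.comp f₁ = g₂.comp f₂ ∧
        Set.range g₁ ∩ Set.range g₂ = Set.range (g₁.comp f₁)

end AEC

/-- `κ` is strongly compact: it is uncountable and regular, and every (proper) `κ`-complete filter
on a set `S` extends to a `κ`-complete ultrafilter on `S`. A filter satisfies
`CardinalInterFilter _ κ` when it is closed under intersections of fewer than `κ` sets. -/
def IsStronglyCompact (κ : Cardinal.{u}) : Prop :=
  ℵ₀ < κ ∧ κ.IsRegular ∧
    ∀ (S : Type u) (F : Filter S), F.NeBot → CardinalInterFilter F κ →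
      ∃ U : Ultrafilter S, (U : Filter S) ≤ F ∧ CardinalInterFilter (U : Filter S) κ

namespace AEC

open FirstOrder.Language Order

variable {L : FirstOrder.Language.{u, u}} (K : AEC L)

/-! The proof amalgamates small pieces and glues the results with an ultraproduct. Strong
compactness gives a fine `κ`-complete ultrafilter on the subsets of `M₁ ⊕ M₂` of size less than `κ`.
For each such subset, Löwenheim–Skolem yields strong substructures of `M₁` and `M₂` of size in `[μ,
κ)` containing its traces. The hypothesis embeds them jointly, or amalgamates them, in some `N i`.
By fineness every point is eventually covered, so the local embeddings induce maps of `M₁` and `M₂`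
into the ultraproduct of the `N i`. Agreement over `M₀` and disjointness pass through the
ultrafilter.

It remains to see that the ultraproduct is in `K` and that the induced maps are `K`-embeddings. AECs
are closed under directed unions (`sSup_spec`), although the axioms speak only of chains. The
ultraproduct is the directed union of its small internal substructures. By `κ`-completeness these
embed into single factors, where coherence applies (`ultraproduct_spec`). Likewise the image of `M₁`
is the directed union of the images of its small strong substructures, and these images are small
internal (`exists_isEmbedding_ultraproduct`). -/

theorem isLSCardinal_LS : K.IsLSCardinal K.LS :=
  csInf_mem K.exists_isLSCardinal

variable {K}

/-! ### Calculus of `K`-embeddings and strong substructures. -/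

section Basic

variable {M N P : Type u} [L.Structure M] [L.Structure N] [L.Structure P]

theorem IsEmbedding.mem_left {f : M ↪[L] N} (hf : K.IsEmbedding f) : K.Mem M :=
  K.mem_of_equiv f.equivRange.symm (K.mem_of_strong _ hf).1

theorem IsEmbedding.mem_right {f : M ↪[L] N} (hf : K.IsEmbedding f) : K.Mem N :=
  (K.mem_of_strong _ hf).2

theorem isEmbedding_subtype {S : L.Substructure M} : K.IsEmbedding S.subtype ↔ K.Strong S := by
  rw [IsEmbedding, Substructure.range_subtype]

theorem IsEmbedding.comp {g : N ↪[L] P} {f : M ↪[L] N} (hg : K.IsEmbedding g)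
    (hf : K.IsEmbedding f) : K.IsEmbedding (g.comp f) := by
  have h := K.strong_trans _ _ (K.strong_map_equiv g.equivRange _ hf) hg
  unfold IsEmbedding
  convert! h using 1
  ext x
  simp only [FirstOrder.Language.Hom.mem_range, Substructure.mem_map]
  constructor
  · rintro ⟨y, rfl⟩
    exact ⟨g.equivRange (f y), ⟨f y, ⟨y, rfl⟩, rfl⟩, rfl⟩
  · rintro ⟨_, ⟨_, ⟨y, rfl⟩, rfl⟩, rfl⟩
    exact ⟨y, rfl⟩

/-- This is coherence inside the range of `g`, transported back along the isomorphism of `N` with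
that range. -/
theorem IsEmbedding.of_comp {g : N ↪[L] P} {f : M ↪[L] N} (hg : K.IsEmbedding g)
    (hgf : K.IsEmbedding (g.comp f)) : K.IsEmbedding f := by
  have hle : (g.comp f).toHom.range ≤ g.toHom.range := by
    rintro _ ⟨x, rfl⟩
    exact ⟨f x, rfl⟩
  have h := K.strong_map_equiv g.equivRange.symm _ (K.coherence _ _ hle hgf hg).2
  unfold IsEmbedding
  convert! h using 1
  ext x
  simp only [FirstOrder.Language.Hom.mem_range, Substructure.mem_map, Substructure.mem_comap]
  constructor
  · rintro ⟨y, rfl⟩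
    exact ⟨g.equivRange (f y), ⟨y, rfl⟩, g.equivRange.symm_apply_apply _⟩
  · rintro ⟨z, ⟨y, hy⟩, rfl⟩
    refine ⟨y, ?_⟩
    have : z = g.equivRange (f y) := Subtype.ext hy.symm
    rw [this]
    exact (g.equivRange.symm_apply_apply _).symm

end Basic

section StrongIn

variable {N : Type u} [L.Structure N] {R S T : L.Substructure N}

theorem strongIn_iff : K.StrongIn S T ↔ ∃ h : S ≤ T, K.IsEmbedding (Substructure.inclusion h) := by
  constructor
  · rintro ⟨h, hs⟩
    refine ⟨h, ?_⟩
    unfold IsEmbedding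
    convert! hs using 1
    ext x
    simp only [FirstOrder.Language.Hom.mem_range, Substructure.mem_comap]
    constructor
    · rintro ⟨y, rfl⟩
      exact y.2
    · intro hx
      exact ⟨⟨x, hx⟩, rfl⟩
  · rintro ⟨h, hs⟩
    refine ⟨h, ?_⟩
    unfold IsEmbedding at hs
    convert! hs using 1
    ext x
    simp only [FirstOrder.Language.Hom.mem_range, Substructure.mem_comap]
    constructor
    · intro hx
      exact ⟨⟨x, hx⟩, rfl⟩
    · rintro ⟨y, rfl⟩
      exact y.2

theorem strongIn_trans (h₁ : K.StrongIn R S) (h₂ : K.StrongIn S T) : K.StrongIn R T := by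
  obtain ⟨h₁, h₁'⟩ := strongIn_iff.1 h₁
  obtain ⟨h₂, h₂'⟩ := strongIn_iff.1 h₂
  exact strongIn_iff.2 ⟨h₁.trans h₂, h₂'.comp h₁'⟩

theorem strongIn_top : K.StrongIn S ⊤ ↔ K.Strong S := by
  constructor
  · rintro ⟨-, h⟩
    convert! K.strong_map_equiv Substructure.topEquiv _ h using 1
    ext x
    simp only [Substructure.mem_map, Substructure.mem_comap]
    constructor
    · intro hx
      exact ⟨⟨x, trivial⟩, hx, rfl⟩
    · rintro ⟨y, hy, rfl⟩
      exact hy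
  · intro h
    exact K.coherence _ _ le_top h (K.strong_refl _ (K.mem_of_strong _ h).2)

theorem mem_of_strongIn_right (h : K.StrongIn S T) : K.Mem T :=
  (strongIn_iff.1 h).2.mem_right

theorem map_comap_subtype (h : S ≤ T) : (S.comap T.subtype.toHom).map T.subtype.toHom = S := by
  ext x
  simp only [Substructure.mem_map, Substructure.mem_comap]
  constructor
  · rintro ⟨y, hy, rfl⟩
    exact hy
  · intro hx
    exact ⟨⟨x, h hx⟩, hx, rfl⟩

/-- Pulling the chain back to `T` reduces this to the union axiom. Unions commute with the pullback
because pushing forward along `T.subtype` is injective. -/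
theorem chain_union_strongIn {δ : Ordinal.{u}} {S : Ordinal.{u} → L.Substructure N}
    (hδ : Order.IsSuccLimit δ) (hS : K.IsContinuousChain δ S) (hT : ∀ i < δ, K.StrongIn (S i) T)
    (hTm : K.Mem T) : K.StrongIn (⨆ i : Set.Iio δ, S i) T := by
  have hinj : Function.Injective (Substructure.map T.subtype.toHom) :=
    Substructure.map_injective_of_injective T.subtype_injective
  have hsup : ∀ j ≤ δ, (⨆ i : Set.Iio j, S i).comap T.subtype.toHom =
      ⨆ i : Set.Iio j, (S i).comap T.subtype.toHom := by
    intro j hj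
    apply hinj
    have hle : (⨆ i : Set.Iio j, S i) ≤ T :=
      iSup_le fun i : Set.Iio j => (hT i.1 (lt_of_lt_of_le i.2 hj)).1
    rw [map_comap_subtype hle, Substructure.map_iSup]
    exact iSup_congr fun i : Set.Iio j => (map_comap_subtype (hT i.1 (lt_of_lt_of_le i.2 hj)).1).symm
  refine ⟨iSup_le fun i => (hT i.1 i.2).1, ?_⟩
  rw [hsup δ le_rfl]
  refine K.chain_union_strong δ (fun i => (S i).comap T.subtype.toHom) hδ ⟨?_, ?_, ?_⟩ hTm
    fun i hi => (hT i hi).2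
  · intro i hi
    exact (K.mem_of_strong _ (hT i hi).2).1
  · intro i j hij hj
    exact K.coherence _ _ (Substructure.monotone_comap (hS.strong i j hij hj).1)
      (hT i (hij.trans_lt hj)).2 (hT j hj).2
  · intro j hj hl
    rw [hS.continuous j hj hl, hsup j hj.le]

end StrongIn

/-! ### Directed unions from continuous chains. -/

section DirectedUnion

/-- By recursion on `s`, take a common upper bound of `s` and of the values already chosen at its
proper subsets. This reindexes a directed system by finite sets, so that every subset of `ι` spans a
directed subsystem. -/
theorem exists_monotone_finset_upperBound (ι : Type u) [PartialOrder ι] [IsDirectedOrder ι]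
    [Nonempty ι] : ∃ f : Finset ι → ι, Monotone f ∧ ∀ s, ∀ a ∈ s, a ≤ f s := by
  classical
  have hex : ∀ (s : Finset ι) (g : (t : Finset ι) → t ⊂ s → ι),
      ∃ b, (∀ a ∈ s, a ≤ b) ∧ ∀ t (h : t ⊂ s), g t h ≤ b := by
    intro s g
    have hss : ∀ t : {t // t ∈ s.ssubsets}, t.1 ⊂ s := fun t => Finset.mem_ssubsets.1 t.2
    let g' : {t // t ∈ s.ssubsets} → ι := fun t => g t.1 (hss t)
    obtain ⟨b, hb⟩ := Finset.exists_le (s ∪ s.ssubsets.attach.image g')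
    refine ⟨b, fun a ha => hb a (Finset.mem_union_left _ ha), fun t ht => hb _ ?_⟩
    exact Finset.mem_union_right _
      (Finset.mem_image.2 ⟨⟨t, Finset.mem_ssubsets.2 ht⟩, Finset.mem_attach _ _, rfl⟩)
  choose F hF using hex
  obtain ⟨f, hf⟩ : ∃ f : Finset ι → ι, ∀ s, f s = F s fun t _ => f t :=
    ⟨fun s => Finset.strongInduction F s, fun s => Finset.strongInduction_eq F s⟩
  refine ⟨f, fun t s hts => ?_, fun s a ha => ?_⟩
  · rcases hts.eq_or_lt with rfl | h
    · exact le_rfl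
    · rw [hf s]
      exact (hF s fun t _ => f t).2 t h
  · rw [hf s]
    exact (hF s _).1 a ha

variable {N : Type u} [L.Structure N] {ι : Type u}

/-- The union of the members of a system of substructures that are indexed by the finite subsets
of `A`. -/
def finsetUnion (S : Finset ι → L.Substructure N) (A : Set ι) : L.Substructure N :=
  ⨆ s : {s : Finset ι // (s : Set ι) ⊆ A}, S s

theorem le_finsetUnion (S : Finset ι → L.Substructure N) {A : Set ι} {s : Finset ι}
    (h : (s : Set ι) ⊆ A) : S s ≤ finsetUnion S A :=
  le_iSup (fun s : {s : Finset ι // (s : Set ι) ⊆ A} => S s) ⟨s, h⟩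

theorem finsetUnion_le {S : Finset ι → L.Substructure N} {A : Set ι} {Q : L.Substructure N}
    (h : ∀ s : Finset ι, (s : Set ι) ⊆ A → S s ≤ Q) : finsetUnion S A ≤ Q :=
  iSup_le fun s => h s s.2

theorem finsetUnion_mono (S : Finset ι → L.Substructure N) {A B : Set ι} (h : A ⊆ B) :
    finsetUnion S A ≤ finsetUnion S B :=
  finsetUnion_le fun _ hs => le_finsetUnion S (hs.trans h)

theorem exists_finset_subset_of_isSuccLimit {A : Ordinal.{u} → Set ι} (hA : Monotone A)
    {j : Ordinal.{u}} (hj : Order.IsSuccLimit j) (hU : A j ⊆ ⋃ i ∈ Set.Iio j, A i) {s : Finset ι}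
    (hs : (s : Set ι) ⊆ A j) : ∃ i < j, (s : Set ι) ⊆ A i := by
    classical
    induction s using Finset.induction_on with
    | empty => exact ⟨⊥, hj.bot_lt, by simp⟩
    | insert a s _ ih =>
      rw [Finset.coe_insert, Set.insert_subset_iff] at hs
      obtain ⟨i, hi, hsi⟩ := ih hs.2
      obtain ⟨i', hi', ha⟩ := Set.mem_iUnion₂.1 (hU hs.1)
      refine ⟨max i i', max_lt hi hi', ?_⟩
      rw [Finset.coe_insert, Set.insert_subset_iff]
      exact ⟨hA (le_max_right _ _) ha, hsi.trans (hA (le_max_left _ _))⟩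

theorem finsetUnion_iUnion_of_isSuccLimit (S : Finset ι → L.Substructure N)
    {A : Ordinal.{u} → Set ι} (hA : Monotone A) {j : Ordinal.{u}} (hj : Order.IsSuccLimit j)
    (hU : A j ⊆ ⋃ i ∈ Set.Iio j, A i) :
    finsetUnion S (A j) = ⨆ i : Set.Iio j, finsetUnion S (A i) := by
  apply le_antisymm
  · refine finsetUnion_le fun s hs => ?_
    obtain ⟨i, hi, hsi⟩ := exists_finset_subset_of_isSuccLimit hA hj hU hs
    exact (le_finsetUnion S hsi).trans
      (le_iSup (fun i : Set.Iio j => finsetUnion S (A i)) ⟨i, hi⟩)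
  · exact iSup_le fun i => finsetUnion_mono S (hA (le_of_lt i.2))

/-- Well-order `A` in its least order type and take initial segments. -/
theorem exists_filtration (A : Set ι) :
    ∃ B : Ordinal.{u} → Set ι, Monotone B ∧ B (#A).ord = A ∧ (∀ i < (#A).ord, #(B i) < #A) ∧
      ∀ j, Order.IsSuccLimit j → B j ⊆ ⋃ i ∈ Set.Iio j, B i := by
  obtain ⟨r, wo, hr⟩ := Cardinal.exists_ord_eq A
  let B : Ordinal.{u} → Set ι := fun i => {a | ∃ h : a ∈ A, Ordinal.typein r ⟨a, h⟩ < i}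
  refine ⟨B, ?_, ?_, ?_, ?_⟩
  · rintro i j hij a ⟨h, ha⟩
    exact ⟨h, ha.trans_le hij⟩
  · ext a
    exact ⟨fun h => h.1, fun h => ⟨h, by rw [hr]; exact Ordinal.typein_lt_type r _⟩⟩
  · intro i hi
    refine lt_of_le_of_lt ?_ (Cardinal.lt_ord.1 hi)
    have hinj : Function.Injective
        (fun a : B i => (⟨Ordinal.typein r ⟨a.1, a.2.1⟩, a.2.2⟩ : Set.Iio i)) := by
      intro a b hab
      have := Ordinal.typein_injective r (Subtype.ext_iff.1 hab)
      exact Subtype.ext (congrArg (fun x : A => x.1) this)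
    have h2 := Cardinal.lift_mk_le_lift_mk_of_injective hinj
    rw [Cardinal.mk_Iio_ordinal] at h2
    rwa [Cardinal.lift_lift, Cardinal.lift_le] at h2
  · rintro j hj a ⟨h, ha⟩
    exact Set.mem_iUnion₂.2 ⟨_, hj.succ_lt ha, h, Order.lt_succ _⟩

variable {S : Finset ι → L.Substructure N}

/-- Induction on `#A`. A finite `A` gives a system with a largest member. An infinite `A` is
filtered by smaller sets, whose unions form a continuous chain. The two claims must be proved
together, since each step of the chain uses both. -/
theorem finsetUnion_spec (hstrong : ∀ s t, s ⊆ t → K.StrongIn (S s) (S t))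
    (A : Set ι) :
    (∀ s : Finset ι, (s : Set ι) ⊆ A → K.StrongIn (S s) (finsetUnion S A)) ∧
      ∀ Q : L.Substructure N, K.Mem Q →
        (∀ s : Finset ι, (s : Set ι) ⊆ A → K.StrongIn (S s) Q) → K.StrongIn (finsetUnion S A) Q := by
  induction hc : #A using WellFoundedLT.induction generalizing A with
  | ind c ih =>
  subst hc
  by_cases hA : #A < ℵ₀
  · have hfin : A.Finite := Cardinal.lt_aleph0_iff_set_finite.1 hA
    have hsub : ∀ s : Finset ι, (s : Set ι) ⊆ A → s ⊆ hfin.toFinset :=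
      fun s hs a ha => hfin.mem_toFinset.2 (hs ha)
    have : finsetUnion S A = S hfin.toFinset :=
      le_antisymm (finsetUnion_le fun s hs => (hstrong _ _ (hsub s hs)).1)
        (le_finsetUnion S (by simp))
    rw [this]
    exact ⟨fun s hs => hstrong _ _ (hsub s hs), fun Q _ h => h _ (by simp)⟩
  · rw [not_lt] at hA
    obtain ⟨B, hBmono, hBA, hBcard, hBlim⟩ := exists_filtration A
    have hδ : Order.IsSuccLimit (#A).ord := Cardinal.isSuccLimit_ord hA
    have hB : ∀ i < (#A).ord, _ := fun i hi => ih _ (hBcard i hi) (B i) rfl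
    have hBm : ∀ i < (#A).ord, K.Mem (finsetUnion S (B i)) :=
      fun i hi => mem_of_strongIn_right ((hB i hi).1 ∅ (by simp))
    have hBsub : ∀ i < (#A).ord, B i ⊆ A := fun i hi => hBA ▸ hBmono hi.le
    have hchain : K.IsContinuousChain (#A).ord fun i => finsetUnion S (B i) := by
      refine ⟨hBm, fun i j hij hj => ?_, fun j _ hl =>
        finsetUnion_iUnion_of_isSuccLimit S hBmono hl (hBlim j hl)⟩
      -- The second claim for `B i`, with the union over `B j` as target; the first claim for `B j`
      -- supplies its premise.
      exact (hB i (hij.trans_lt hj)).2 _ (hBm j hj)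
        fun s hs => (hB j hj).1 s (hs.trans (hBmono hij))
    have hunion := finsetUnion_iUnion_of_isSuccLimit S hBmono hδ (hBlim _ hδ)
    rw [hBA] at hunion
    have hstr := K.chain_strong _ _ hδ hchain
    rw [← hunion] at hstr
    refine ⟨fun s hs => ?_, fun Q hQ hsQ => ?_⟩
    · obtain ⟨i, hi, hsi⟩ := exists_finset_subset_of_isSuccLimit hBmono hδ (hBlim _ hδ)
        (hs.trans hBA.ge)
      exact strongIn_trans ((hB i hi).1 s hsi) (hstr i hi)
    · rw [hunion]
      exact chain_union_strongIn (S := fun i => finsetUnion S (B i)) hδ hchain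
        (fun i hi => (hB i hi).2 Q hQ fun s hs => hsQ s (hs.trans (hBsub i hi))) hQ

/-- A directed union of members of `K` belongs to `K`, its members are strong in it, and it is
strong in every member of `K` in which its members are strong. -/
theorem sSup_spec {D : Set (L.Substructure N)} (hne : D.Nonempty)
    (hdir : DirectedOn (· ≤ ·) D)
    (hstrong : ∀ S ∈ D, ∀ T ∈ D, S ≤ T → K.StrongIn S T) :
    (∀ S ∈ D, K.StrongIn S (sSup D)) ∧
      ∀ Q : L.Substructure N, K.Mem Q → (∀ S ∈ D, K.StrongIn S Q) → K.StrongIn (sSup D) Q := by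
  have : Nonempty D := hne.to_subtype
  have : IsDirectedOrder D := ⟨directedOn_iff_directed.1 hdir⟩
  obtain ⟨f, hf, hfle⟩ := exists_monotone_finset_upperBound D
  have h := finsetUnion_spec (K := K) (S := fun s => (f s : L.Substructure N))
    (fun s t hst => hstrong _ (f s).2 _ (f t).2 (hf hst)) Set.univ
  have heq : finsetUnion (fun s => (f s : L.Substructure N)) Set.univ = sSup D := by
    apply le_antisymm
    · exact finsetUnion_le fun s _ => le_sSup (f s).2
    · refine sSup_le fun S hS => ?_
      exact (show S ≤ f {⟨S, hS⟩} from hfle {⟨S, hS⟩} ⟨S, hS⟩ (by simp)).trans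
        (le_finsetUnion (fun s => (f s : L.Substructure N)) (Set.subset_univ _))
  rw [heq] at h
  refine ⟨fun S hS => ?_, fun Q hQ hSQ => h.2 Q hQ fun s _ => hSQ _ (f s).2⟩
  exact strongIn_trans (hstrong _ hS _ (f _).2 (hfle {⟨S, hS⟩} ⟨S, hS⟩ (by simp)))
    (h.1 {⟨S, hS⟩} (Set.subset_univ _))

theorem strong_sSup {D : Set (L.Substructure N)} (hne : D.Nonempty)
    (hdir : DirectedOn (· ≤ ·) D) (h : ∀ S ∈ D, K.Strong S) : K.Strong (sSup D) := by
  obtain ⟨S, hS⟩ := hne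
  have hN := K.strong_refl _ (K.mem_of_strong _ (h S hS)).2
  exact strongIn_top.1 ((sSup_spec ⟨S, hS⟩ hdir fun S hS T hT hST => K.coherence _ _ hST (h S hS) (h T hT)).2 ⊤ (K.mem_of_strong _ hN).1
    fun S hS => strongIn_top.2 (h S hS))

end DirectedUnion

/-! ### Ultraproducts by `κ`-complete ultrafilters. -/

section Ultraproduct

variable {I : Type u} (U : Ultrafilter I) {N : I → Type u}

/-- The class of `x` in the ultraproduct. -/
def ultraMk (x : ∀ i, N i) : (U : Filter I).Product N :=
  Quotient.mk'' x

variable {U}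

theorem ultraMk_surjective : Function.Surjective (ultraMk U (N := N)) :=
  Quotient.mk''_surjective

theorem ultraMk_eq_iff {x y : ∀ i, N i} : ultraMk U x = ultraMk U y ↔ ∀ᶠ i in U, x i = y i :=
  Quotient.eq''

variable [∀ i, L.Structure (N i)]

theorem funMap_ultraMk {n : ℕ} (f : L.Functions n) (x : Fin n → ∀ i, N i) :
    Structure.funMap f (fun k => ultraMk U (x k)) =
      ultraMk U fun i => Structure.funMap f fun k => x k i :=
  Ultraproduct.funMap_cast f x

theorem relMap_ultraMk {n : ℕ} (r : L.Relations n) (x : Fin n → ∀ i, N i) :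
    Structure.RelMap r (fun k => ultraMk U (x k)) ↔
      ∀ᶠ i in U, Structure.RelMap r fun k => x k i :=
  relMap_quotient_mk' (s := (U : Filter I).productSetoid N) r x

variable {κ : Cardinal.{u}}

theorem mk_fin_arrow_lt {S : Type u} (hκ : ℵ₀ < κ) (hS : #S < κ) (n : ℕ) : #(Fin n → S) < κ := by
  have : #(Fin n → S) = #S ^ (n : Cardinal.{u}) := by simp
  rw [this]
  exact (Cardinal.power_nat_le_max).trans_lt (max_lt hS hκ)

theorem mk_functions_lt (hL : L.card < κ) (n : ℕ) : #(L.Functions n) < κ :=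
  (Cardinal.mk_le_of_injective (f := fun f => (Sum.inl ⟨n, f⟩ : L.Symbols)) fun f g h => by
    simpa using h).trans_lt hL

theorem mk_relations_lt (hL : L.card < κ) (n : ℕ) : #(L.Relations n) < κ :=
  (Cardinal.mk_le_of_injective (f := fun f => (Sum.inr ⟨n, f⟩ : L.Symbols)) fun f g h => by
    simpa using h).trans_lt hL

variable [CardinalInterFilter (U : Filter I) κ]

theorem eventually_forall_symbols_tuples (hκ : ℵ₀ < κ) {F : ℕ → Type u} (hF : ∀ n, #(F n) < κ)
    {S : Type u} (hS : #S < κ) {p : I → ∀ n, F n → (Fin n → S) → Prop}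
    (h : ∀ n f x, ∀ᶠ i in U, p i n f x) : ∀ᶠ i in U, ∀ n f x, p i n f x := by
  have := CardinalInterFilter.toCountableInterFilter (U : Filter I) hκ
  rw [eventually_countable_forall]
  intro n
  rw [Filter.eventually_cardinal_forall (hF n)]
  intro f
  rw [Filter.eventually_cardinal_forall (mk_fin_arrow_lt hκ hS n)]
  exact h n f

/-- Otherwise the fewer than `κ` complements would all be large, and so would their intersection. -/
theorem exists_eventually_eq {T : Type u} (hT : #T < κ) {p : I → T → Prop}
    (h : ∀ᶠ i in U, ∃ t, p i t) : ∃ t, ∀ᶠ i in U, p i t := by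
  by_contra! hne
  have h' : ∀ᶠ i in U, ∀ t, ¬ p i t := by
    rw [Filter.eventually_cardinal_forall hT]
    exact hne
  obtain ⟨i, ⟨t, ht⟩, hi⟩ := (h.and h').exists
  exact hi t ht

/-- A small substructure of a `κ`-complete ultraproduct embeds into almost all factors. -/
theorem eventually_exists_embedding (hκ : ℵ₀ < κ) (hL : L.card < κ)
    {S : L.Substructure ((U : Filter I).Product N)} (hS : #S < κ) {T : Type u} (hT : #T < κ)
    (x : T → ∀ i, N i) (hx : ∀ t, ultraMk U (x t) ∈ S) :
    ∀ᶠ i in U, ∃ φ : S ↪[L] N i, ∀ t, φ ⟨ultraMk U (x t), hx t⟩ = x t i := by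
  -- With representatives fixed, each instance of injectivity, of preservation of a symbol, or of
  -- agreement with `x` holds almost everywhere. There are fewer than `κ` instances of each kind, so
  -- almost every index satisfies all of them.
  choose r hr using fun s : S => ultraMk_surjective (s : (U : Filter I).Product N)
  have hinj : ∀ᶠ i in U, ∀ s t : S, r s i = r t i → s = t := by
    rw [Filter.eventually_cardinal_forall hS]
    intro s
    rw [Filter.eventually_cardinal_forall hS]
    intro t
    by_cases hst : s = t
    · exact Filter.Eventually.of_forall fun _ _ => hst
    · refine (Ultrafilter.eventually_not.2 fun h => hst ?_).mono fun i hi h => absurd h hi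
      rw [← ultraMk_eq_iff, hr, hr] at h
      exact Subtype.ext h
  have hfun : ∀ᶠ i in U, ∀ n (f : L.Functions n) (y : Fin n → S),
      r (Structure.funMap f y) i = Structure.funMap f fun k => r (y k) i := by
    refine eventually_forall_symbols_tuples hκ (mk_functions_lt hL) hS fun n f y => ?_
    rw [← ultraMk_eq_iff (y := fun i => Structure.funMap f fun k => r (y k) i), hr,
      ← funMap_ultraMk]
    simp only [hr]
    rfl
  have hrel : ∀ᶠ i in U, ∀ n (f : L.Relations n) (y : Fin n → S),
      (Structure.RelMap f fun k => r (y k) i) ↔ Structure.RelMap f y := by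
    refine eventually_forall_symbols_tuples hκ (mk_relations_lt hL) hS fun n f y => ?_
    have h : Structure.RelMap f y ↔ ∀ᶠ i in U, Structure.RelMap f fun k => r (y k) i := by
      rw [← relMap_ultraMk]
      simp only [hr]
      rfl
    by_cases hy : Structure.RelMap f y
    · exact (h.1 hy).mono fun i hi => iff_of_true hi hy
    · exact (Ultrafilter.eventually_not.2 (mt h.2 hy)).mono fun i hi => iff_of_false hi hy
  have hval : ∀ᶠ i in U, ∀ t, r ⟨ultraMk U (x t), hx t⟩ i = x t i := by
    rw [Filter.eventually_cardinal_forall hT]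
    exact fun t => ultraMk_eq_iff.1 (hr _)
  filter_upwards [hinj, hfun, hrel, hval] with i hinj hfun hrel hval
  exact ⟨⟨⟨fun s => r s i, fun s t h => hinj s t h⟩, fun f y => hfun _ f y,
    fun f y => hrel _ f y⟩, hval⟩

variable (K κ) in
/-- `S` is the ultraproduct of strong substructures of the factors, which are enumerated by a set
of cardinality less than `κ`. -/
def IsSmallInternal (S : L.Substructure ((U : Filter I).Product N)) : Prop :=
  ∃ (T : Type u) (e : T → ∀ i, N i), #T < κ ∧
    (S : Set ((U : Filter I).Product N)) = Set.range (fun t => ultraMk U (e t)) ∧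
    ∀ᶠ i in U, ∃ R : L.Substructure (N i),
      K.Strong R ∧ (R : Set (N i)) = Set.range fun t => e t i

/-- A single good factor suffices: some embedding of `S'` into it carries both `S` and `S'` onto
strong substructures, and coherence pulls this back. -/
theorem IsSmallInternal.strongIn (hκ : ℵ₀ < κ) (hL : L.card < κ)
    {S S' : L.Substructure ((U : Filter I).Product N)} (hS : K.IsSmallInternal κ S)
    (hS' : K.IsSmallInternal κ S') (hle : S ≤ S') : K.StrongIn S S' := by
  obtain ⟨T, e, hT, hSe, he⟩ := hS
  obtain ⟨T', e', hT', hSe', he'⟩ := hS'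
  have hcard : #S' < κ := by
    have : #S' = #(Set.range fun t => ultraMk U (e' t)) := by rw [← hSe']; rfl
    rw [this]
    exact Cardinal.mk_range_le.trans_lt hT'
  have hmem : ∀ t, ultraMk U (e t) ∈ S := fun t => by
    rw [← SetLike.mem_coe, hSe]
    exact ⟨t, rfl⟩
  have hmem' : ∀ t, ultraMk U (e' t) ∈ S' := fun t => by
    rw [← SetLike.mem_coe, hSe']
    exact ⟨t, rfl⟩
  have hsum : #(T ⊕ T') < κ := by
    rw [Cardinal.mk_sum, Cardinal.lift_id, Cardinal.lift_id]
    exact Cardinal.add_lt_of_lt hκ.le hT hT'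
  have hφ := eventually_exists_embedding hκ hL hcard hsum (Sum.elim e e')
    (Sum.rec (fun t => hle (hmem t)) hmem')
  obtain ⟨i, ⟨φ, hφ⟩, ⟨R, hR, hRe⟩, ⟨R', hR', hRe'⟩⟩ := (hφ.and (he.and he')).exists
  have h1 : φ.toHom.range = R' := by
    apply SetLike.coe_injective
    rw [hRe', Hom.range_coe]
    ext y
    constructor
    · rintro ⟨⟨s, hs⟩, rfl⟩
      rw [← SetLike.mem_coe, hSe'] at hs
      obtain ⟨t, rfl⟩ := hs
      exact ⟨t, (hφ (Sum.inr t)).symm⟩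
    · rintro ⟨t, rfl⟩
      exact ⟨_, hφ (Sum.inr t)⟩
  have h2 : (φ.comp (Substructure.inclusion hle)).toHom.range = R := by
    apply SetLike.coe_injective
    rw [hRe, Hom.range_coe]
    ext y
    constructor
    · rintro ⟨⟨s, hs⟩, rfl⟩
      have hs' := hs
      rw [← SetLike.mem_coe, hSe] at hs'
      obtain ⟨t, rfl⟩ := hs'
      exact ⟨t, (hφ (Sum.inl t)).symm⟩
    · rintro ⟨t, rfl⟩
      exact ⟨⟨_, hmem t⟩, hφ (Sum.inl t)⟩
  refine strongIn_iff.2 ⟨hle, IsEmbedding.of_comp (g := φ) ?_ ?_⟩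
  · rw [IsEmbedding, h1]
    exact hR'
  · rw [IsEmbedding, h2]
    exact hR

/-- Löwenheim–Skolem substructures of the factors have a size bound independent of `i`, so one index
set `T'` enumerates them all. Their ultraproduct is then small by `κ`-completeness. -/
theorem exists_isSmallInternal (hκ : ℵ₀ < κ) (hLS : K.LS < κ) [∀ i, Nonempty (N i)]
    (hN : ∀ i, K.Mem (N i)) {T : Type u} (hT : #T < κ) (x : T → ∀ i, N i) :
    ∃ S : L.Substructure ((U : Filter I).Product N),
      K.IsSmallInternal κ S ∧ ∀ t, ultraMk U (x t) ∈ S := by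
  obtain ⟨y⟩ : Nonempty (∀ i, N i) := inferInstance
  -- The extra point `y i` keeps `R i` nonempty, so that `T'` can be mapped onto it even when `T` is
  -- empty.
  have hA : ∀ i, #(insert (y i) (Set.range fun t => x t i) : Set (N i)) ≤ #T + 1 := fun i =>
    Cardinal.mk_insert_le.trans (by gcongr; exact Cardinal.mk_range_le)
  choose R hR hAR hRcard using fun i =>
    K.isLSCardinal_LS.2.2 (N i) (hN i) (insert (y i) (Set.range fun t => x t i))
  have hlt : #T + 1 + K.LS < κ :=
    Cardinal.add_lt_of_lt hκ.le (Cardinal.add_lt_of_lt hκ.le hT (Cardinal.one_lt_aleph0.trans hκ))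
      hLS
  induction hc : #T + 1 + K.LS using Cardinal.inductionOn with
  | mk T' =>
  have he : ∀ i, ∃ e : T' → N i, Set.range e = R i := by
    intro i
    have hle : #(R i) ≤ #T' := by
      rw [← hc]
      exact (hRcard i).trans (by gcongr; exact hA i)
    obtain ⟨f⟩ := Cardinal.le_def _ _ |>.1 hle
    have : Nonempty (R i) := ⟨⟨y i, hAR i (Set.mem_insert _ _)⟩⟩
    refine ⟨fun t => (Function.invFun (f : R i → T') t : R i), ?_⟩
    rw [Set.range_comp' Subtype.val, (Function.invFun_surjective f.injective).range_eq]
    simp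
  choose e he using he
  -- A section of the `R i` picks an index in `T'` at each `i`, and that index can be taken constant
  -- almost everywhere. This gives closure under the functions.
  have hmem : ∀ z : ∀ i, N i, (∀ i, z i ∈ R i) → ∃ t, ultraMk U (fun i => e i t) = ultraMk U z := by
    intro z hz
    have : ∀ i, ∃ t, e i t = z i := fun i => by
      have := hz i
      rw [← SetLike.mem_coe, ← he i] at this
      exact this
    obtain ⟨t, ht⟩ := exists_eventually_eq (hc ▸ hlt) (Filter.Eventually.of_forall (f := U) this)
    exact ⟨t, ultraMk_eq_iff.2 ht⟩
  have heR : ∀ i t, e i t ∈ R i := fun i t => by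
    rw [← SetLike.mem_coe, ← he i]
    exact ⟨t, rfl⟩
  refine ⟨⟨Set.range fun t => ultraMk U fun i => e i t, ?_⟩, ⟨T', fun t i => e i t, hc ▸ hlt, rfl,
    Filter.Eventually.of_forall fun i => ⟨R i, hR i, (he i).symm⟩⟩, fun t => ?_⟩
  · intro n f z hz
    choose t ht using hz
    obtain ⟨s, hs⟩ := hmem (fun i => Structure.funMap f fun k => e i (t k)) fun i =>
      (R i).fun_mem f _ fun k => heR i (t k)
    refine ⟨s, ?_⟩
    simp only [hs]
    rw [← funMap_ultraMk f fun k i => e i (t k)]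
    simp only [ht]
  · exact hmem (x t) fun i => hAR i (Set.mem_insert_of_mem _ ⟨t, rfl⟩)

/-- A `κ`-complete ultraproduct of members of `K` belongs to `K`, and its small internal
substructures are strong. -/
theorem ultraproduct_spec (hκ : ℵ₀ < κ) (hLS : K.LS < κ) [∀ i, Nonempty (N i)]
    (hN : ∀ i, K.Mem (N i)) :
    K.Mem ((U : Filter I).Product N) ∧
      ∀ S : L.Substructure ((U : Filter I).Product N), K.IsSmallInternal κ S → K.Strong S := by
  have hL : L.card < κ := K.isLSCardinal_LS.2.1.trans_lt hLS
  have hstr : ∀ S ∈ {S : L.Substructure ((U : Filter I).Product N) | K.IsSmallInternal κ S},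
      ∀ S' ∈ {S : L.Substructure ((U : Filter I).Product N) | K.IsSmallInternal κ S},
      S ≤ S' → K.StrongIn S S' := fun S hS S' hS' hle => hS.strongIn hκ hL hS' hle
  obtain ⟨S₀, hS₀, -⟩ := exists_isSmallInternal (U := U) hκ hLS hN (T := PEmpty.{u+1})
    (by simpa using Cardinal.aleph0_pos.trans hκ) PEmpty.elim
  have hdir : DirectedOn (· ≤ ·)
      {S : L.Substructure ((U : Filter I).Product N) | K.IsSmallInternal κ S} := by
    rintro S ⟨T, e, hT, hSe, -⟩ S' ⟨T', e', hT', hSe', -⟩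
    obtain ⟨R, hR, hRe⟩ := exists_isSmallInternal (U := U) hκ hLS hN (T := T ⊕ T')
      (by
        rw [Cardinal.mk_sum, Cardinal.lift_id, Cardinal.lift_id]
        exact Cardinal.add_lt_of_lt hκ.le hT hT') (Sum.elim e e')
    refine ⟨R, hR, ?_, ?_⟩
    · intro s hs
      rw [← SetLike.mem_coe, hSe] at hs
      obtain ⟨t, rfl⟩ := hs
      exact hRe (Sum.inl t)
    · intro s hs
      rw [← SetLike.mem_coe, hSe'] at hs
      obtain ⟨t, rfl⟩ := hs
      exact hRe (Sum.inr t)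
  have htop : sSup {S : L.Substructure ((U : Filter I).Product N) | K.IsSmallInternal κ S} = ⊤ := by
    refine eq_top_iff.2 fun s _ => ?_
    obtain ⟨x, rfl⟩ := ultraMk_surjective s
    obtain ⟨R, hR, hRe⟩ := exists_isSmallInternal (U := U) hκ hLS hN (T := PUnit.{u+1})
      (by simpa using Cardinal.one_lt_aleph0.trans hκ) (fun _ => x)
    exact (le_sSup hR : R ≤ _) (hRe PUnit.unit)
  have h := (sSup_spec ⟨S₀, hS₀⟩ hdir hstr).1
  rw [htop] at h
  exact ⟨(K.mem_of_strong _ (strongIn_top.1 (h S₀ hS₀))).2, fun S hS => strongIn_top.1 (h S hS)⟩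

end Ultraproduct

/-! ### Embeddings into ultraproducts and fine ultrafilters. -/

variable {κ : Cardinal.{u}}

theorem exists_strong_of_card_lt (hκ : ℵ₀ < κ) (hLS : K.LS < κ) {M : Type u} [L.Structure M]
    (hM : K.Mem M) {A : Set M} (hA : #A < κ) :
    ∃ S : L.Substructure M, K.Strong S ∧ A ⊆ S ∧ #S < κ := by
  obtain ⟨S, hS, hAS, hcard⟩ := K.isLSCardinal_LS.2.2 M hM A
  exact ⟨S, hS, hAS, hcard.trans_lt (Cardinal.add_lt_of_lt hκ.le hA hLS)⟩

theorem card_union_lt (hκ : ℵ₀ < κ) {X : Type u} {A B : Set X} (hA : #A < κ) (hB : #B < κ) :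
    #(A ∪ B : Set X) < κ :=
  (Cardinal.mk_union_le _ _).trans_lt (Cardinal.add_lt_of_lt hκ.le hA hB)

section Ultraproduct

variable {I : Type u} {U : Ultrafilter I} {N : I → Type u} [∀ i, L.Structure (N i)]
  [CardinalInterFilter (U : Filter I) κ]

/-- Compatible `K`-embeddings of strong substructures that exhaust `M` along the ultrafilter
induce a `K`-embedding of `M` into the ultraproduct. -/
theorem exists_isEmbedding_ultraproduct (hκ : ℵ₀ < κ) (hLS : K.LS < κ) [∀ i, Nonempty (N i)]
    (hN : ∀ i, K.Mem (N i)) {M : Type u} [L.Structure M] (hM : K.Mem M)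
    {P : I → L.Substructure M} (hP : ∀ i, K.Strong (P i)) (hPm : ∀ m, ∀ᶠ i in U, m ∈ P i)
    {g : ∀ i, P i ↪[L] N i} (hg : ∀ i, K.IsEmbedding (g i)) :
    ∃ (G : M ↪[L] (U : Filter I).Product N) (x : M → ∀ i, N i), K.IsEmbedding G ∧
      (∀ m, G m = ultraMk U (x m)) ∧ ∀ m, ∀ᶠ i in U, ∃ h : m ∈ P i, g i ⟨m, h⟩ = x m i := by
  classical
  obtain ⟨y⟩ : Nonempty (∀ i, N i) := inferInstance
  obtain ⟨x, hx⟩ : ∃ x : M → ∀ i, N i, ∀ m, ∀ᶠ i in U, ∃ h : m ∈ P i, g i ⟨m, h⟩ = x m i := by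
    -- The default `y i` is used only on a null set of indices.
    refine ⟨fun m i => if h : m ∈ P i then g i ⟨m, h⟩ else y i, fun m => ?_⟩
    filter_upwards [hPm m] with i hi
    exact ⟨hi, by simp [hi]⟩
  have hinj : Function.Injective fun m => ultraMk U (x m) := by
    intro m m' h
    obtain ⟨i, h, ⟨hm, h1⟩, ⟨hm', h2⟩⟩ :=
      ((ultraMk_eq_iff.1 h).and ((hx m).and (hx m'))).exists
    rw [← h1, ← h2] at h
    exact congrArg Subtype.val ((g i).injective h)
  have hfun : ∀ {n} (f : L.Functions n) (z : Fin n → M),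
      ultraMk U (x (Structure.funMap f z)) = Structure.funMap f fun k => ultraMk U (x (z k)) := by
    intro n f z
    rw [funMap_ultraMk, ultraMk_eq_iff]
    filter_upwards [hx (Structure.funMap f z), Filter.eventually_all.2 fun k => hx (z k)]
      with i ⟨h, h1⟩ h2
    choose h2 h3 using h2
    rw [← h1]
    simp only [← h3]
    exact (g i).map_fun f fun k => ⟨z k, h2 k⟩
  have hrel : ∀ {n} (r : L.Relations n) (z : Fin n → M),
      (Structure.RelMap r fun k => ultraMk U (x (z k))) ↔ Structure.RelMap r z := by
    intro n r z
    have h : ∀ᶠ i in U, (Structure.RelMap r fun k => x (z k) i) ↔ Structure.RelMap r z := by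
      filter_upwards [Filter.eventually_all.2 fun k => hx (z k)] with i h2
      choose h2 h3 using h2
      simp only [← h3]
      exact (g i).map_rel r fun k => ⟨z k, h2 k⟩
    rw [relMap_ultraMk, Filter.eventually_congr h, Filter.eventually_const]
  let G : M ↪[L] (U : Filter I).Product N := ⟨⟨fun m => ultraMk U (x m), hinj⟩, hfun, hrel⟩
  refine ⟨G, x, ?_, fun m => rfl, hx⟩
  -- By `κ`-completeness, almost every `P i` contains all of `Q`. There `Q ≺ P i` by coherence, so
  -- `g i` maps `Q` onto a strong substructure of `N i`, and the image of `Q` is small internal.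
  have hsmall : ∀ Q : L.Substructure M, K.Strong Q → #Q < κ → K.Strong (Q.map G.toHom) := by
    intro Q hQ hQc
    refine (ultraproduct_spec hκ hLS hN).2 _ ⟨Q, fun q => x q, hQc, ?_, ?_⟩
    · ext z
      constructor
      · rintro ⟨q, hq, rfl⟩
        exact ⟨⟨q, hq⟩, rfl⟩
      · rintro ⟨q, rfl⟩
        exact ⟨q, q.2, rfl⟩
    · filter_upwards [(Filter.eventually_cardinal_forall hQc).2 fun q : Q => hx q] with i hi
      choose h1 h2 using hi
      obtain ⟨hle, hincl⟩ := strongIn_iff.1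
        (K.coherence Q (P i) (fun q hq => h1 ⟨q, hq⟩) hQ (hP i))
      refine ⟨((g i).comp (Substructure.inclusion hle)).toHom.range, (hg i).comp hincl, ?_⟩
      rw [Hom.range_coe]
      exact congrArg Set.range (funext h2)
  have hrange : G.toHom.range =
      sSup ((Substructure.map G.toHom) '' {Q : L.Substructure M | K.Strong Q ∧ #Q < κ}) := by
    apply le_antisymm
    · rintro _ ⟨m, rfl⟩
      obtain ⟨Q, hQ, hmQ, hQc⟩ := exists_strong_of_card_lt hκ hLS hM (A := {m})
        (by simpa using Cardinal.one_lt_aleph0.trans hκ)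
      have hle : Q.map G.toHom ≤
          sSup ((Substructure.map G.toHom) '' {Q : L.Substructure M | K.Strong Q ∧ #Q < κ}) :=
        le_sSup ⟨Q, ⟨hQ, hQc⟩, rfl⟩
      exact hle ⟨m, hmQ rfl, rfl⟩
    · refine sSup_le ?_
      rintro _ ⟨Q, -, rfl⟩
      exact Hom.map_le_range
  rw [IsEmbedding, hrange]
  apply strong_sSup
  · obtain ⟨Q, hQ, -, hQc⟩ := exists_strong_of_card_lt hκ hLS hM (A := ∅)
      (by simpa using Cardinal.aleph0_pos.trans hκ)
    exact ⟨_, Q, ⟨hQ, hQc⟩, rfl⟩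
  · rintro _ ⟨Q, ⟨hQ, hQc⟩, rfl⟩ _ ⟨Q', ⟨hQ', hQc'⟩, rfl⟩
    obtain ⟨R, hR, hQR, hRc⟩ := exists_strong_of_card_lt hκ hLS hM
      (card_union_lt hκ (A := (Q : Set M)) (B := (Q' : Set M)) hQc hQc')
    exact ⟨_, ⟨R, ⟨hR, hRc⟩, rfl⟩,
      Substructure.monotone_map fun q hq => hQR (Or.inl hq),
      Substructure.monotone_map fun q hq => hQR (Or.inr hq)⟩
  · rintro _ ⟨Q, ⟨hQ, hQc⟩, rfl⟩
    exact hsmall Q hQ hQc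

end Ultraproduct

/-- Fine `κ`-complete ultrafilters exist over every set. -/
theorem exists_fine_ultrafilter (hκ : IsStronglyCompact κ) (X : Type u) :
    ∃ (I : Type u) (s : I → Set X) (U : Ultrafilter I), (∀ i, #(s i) < κ) ∧
      CardinalInterFilter (U : Filter I) κ ∧ ∀ x, ∀ᶠ i in U, x ∈ s i := by
  obtain ⟨hω, hreg, hκ⟩ := hκ
  let I := {s : Set X // #s < κ}
  have : Nonempty I := ⟨⟨∅, by simpa using Cardinal.aleph0_pos.trans hω⟩⟩
  have : IsDirectedOrder I := ⟨fun s t => ⟨⟨s.1 ∪ t.1, card_union_lt hω s.2 t.2⟩,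
    Set.subset_union_left, Set.subset_union_right⟩⟩
  -- Regularity of `κ` keeps the union of fewer than `κ` small sets small, so fewer than `κ` cones
  -- contain a common cone.
  have hcomplete : CardinalInterFilter (Filter.atTop : Filter I) κ := by
    refine ⟨fun S hS h => ?_⟩
    choose a ha using fun s : S => Filter.mem_atTop_sets.1 (h s s.2)
    have hcard : #(⋃ s : S, (a s).1 : Set X) < κ :=
      (Cardinal.card_iUnion_lt_iff_forall_of_isRegular hreg hS).2 fun s => (a s).2
    refine Filter.mem_atTop_sets.2 ⟨⟨_, hcard⟩, fun b hb s hs => ha ⟨s, hs⟩ b ?_⟩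
    exact (Set.subset_iUnion (fun s : S => (a s).1) ⟨s, hs⟩).trans hb
  obtain ⟨U, hU, hUc⟩ := hκ I Filter.atTop inferInstance hcomplete
  refine ⟨I, Subtype.val, U, fun i => i.2, hUc, fun x => hU ?_⟩
  refine Filter.mem_atTop_sets.2 ⟨⟨{x}, by simpa using Cardinal.one_lt_aleph0.trans hω⟩, ?_⟩
  exact fun b hb => hb rfl

/-! ### Transfer of joint embedding and amalgamation. -/

theorem jep_Ici {μ : Cardinal.{u}} (hκ : IsStronglyCompact κ) (hLS : K.LS < κ) (hμ : μ < κ)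
    (h : K.JEP (Set.Ico μ κ)) : K.JEP (Set.Ici μ) := by
  intro M₁ M₂ _ _ hM₁ hM₂ hc₁ hc₂
  -- The ultraproduct construction needs nonempty factors. If both models are empty, their size is
  -- below `κ` and the hypothesis applies directly; otherwise a point `x₀` is added to every small
  -- set.
  rcases isEmpty_or_nonempty (M₁ ⊕ M₂) with hE | hne
  · rw [isEmpty_sum] at hE
    have h0 := Cardinal.aleph0_pos.trans hκ.1
    refine h M₁ M₂ hM₁ hM₂ ⟨hc₁, ?_⟩ ⟨hc₂, ?_⟩
    · rwa [Cardinal.mk_eq_zero_iff.2 hE.1]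
    · rwa [Cardinal.mk_eq_zero_iff.2 hE.2]
  obtain ⟨x₀⟩ := hne
  obtain ⟨I, s, U, hs, hU, hfine⟩ := exists_fine_ultrafilter hκ (M₁ ⊕ M₂)
  -- A set of size exactly `μ`, put into every small substructure to keep its size in `[μ, κ)`.
  obtain ⟨p₁, hp₁⟩ := Cardinal.le_mk_iff_exists_set.1 hc₁
  obtain ⟨p₂, hp₂⟩ := Cardinal.le_mk_iff_exists_set.1 hc₂
  have hs' : ∀ i, #(insert x₀ (s i) : Set (M₁ ⊕ M₂)) < κ := fun i =>
    Cardinal.mk_insert_le.trans_lt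
      (Cardinal.add_lt_of_lt hκ.1.le (hs i) (Cardinal.one_lt_aleph0.trans hκ.1))
  choose P₁ hP₁ hsP₁ hPc₁ using fun i => exists_strong_of_card_lt hκ.1 hLS hM₁
    (card_union_lt hκ.1 ((Cardinal.mk_preimage_of_injective _ _ Sum.inl_injective).trans_lt (hs' i))
      (hp₁.trans_lt hμ))
  choose P₂ hP₂ hsP₂ hPc₂ using fun i => exists_strong_of_card_lt hκ.1 hLS hM₂
    (card_union_lt hκ.1 ((Cardinal.mk_preimage_of_injective _ _ Sum.inr_injective).trans_lt (hs' i))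
      (hp₂.trans_lt hμ))
  choose N inst g₁ g₂ hg₁ hg₂ using fun i => h (P₁ i) (P₂ i)
    (K.mem_of_strong _ (hP₁ i)).1 (K.mem_of_strong _ (hP₂ i)).1
    ⟨hp₁.ge.trans (Cardinal.mk_le_mk_of_subset (Set.subset_union_right.trans (hsP₁ i))), hPc₁ i⟩
    ⟨hp₂.ge.trans (Cardinal.mk_le_mk_of_subset (Set.subset_union_right.trans (hsP₂ i))), hPc₂ i⟩
  have hne : ∀ i, Nonempty (N i) := fun i => by
    rcases x₀ with m | m
    · exact ⟨g₁ i ⟨m, hsP₁ i (Or.inl (Set.mem_insert _ _))⟩⟩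
    · exact ⟨g₂ i ⟨m, hsP₂ i (Or.inl (Set.mem_insert _ _))⟩⟩
  obtain ⟨G₁, -, hG₁, -⟩ := exists_isEmbedding_ultraproduct (U := U) hκ.1 hLS
    (fun i => (hg₁ i).mem_right) hM₁ hP₁
    (fun m => (hfine (Sum.inl m)).mono fun i hi => hsP₁ i (Or.inl (Set.mem_insert_of_mem _ hi))) hg₁
  obtain ⟨G₂, -, hG₂, -⟩ := exists_isEmbedding_ultraproduct (U := U) hκ.1 hLS
    (fun i => (hg₁ i).mem_right) hM₂ hP₂
    (fun m => (hfine (Sum.inr m)).mono fun i hi => hsP₂ i (Or.inl (Set.mem_insert_of_mem _ hi))) hg₂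
  exact ⟨_, _, G₁, G₂, hG₁, hG₂⟩

variable (K) in
/-- The amalgamation property for the members of `K` whose cardinality lies in `F`, with disjoint
amalgams if `d` holds. -/
def Amalgamation (d : Prop) (F : Set Cardinal.{u}) : Prop :=
  ∀ (M₀ M₁ M₂ : Type u) [L.Structure M₀] [L.Structure M₁] [L.Structure M₂],
    K.Mem M₀ → K.Mem M₁ → K.Mem M₂ → #M₀ ∈ F → #M₁ ∈ F → #M₂ ∈ F →
    ∀ (f₁ : M₀ ↪[L] M₁) (f₂ : M₀ ↪[L] M₂), K.IsEmbedding f₁ → K.IsEmbedding f₂ →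
    ∃ (N : Type u) (_ : L.Structure N) (g₁ : M₁ ↪[L] N) (g₂ : M₂ ↪[L] N),
      K.IsEmbedding g₁ ∧ K.IsEmbedding g₂ ∧ (∀ m, g₁ (f₁ m) = g₂ (f₂ m)) ∧
        (d → ∀ m₁ m₂, g₁ m₁ = g₂ m₂ → ∃ m, f₁ m = m₁ ∧ f₂ m = m₂)

theorem ap_iff {F : Set Cardinal.{u}} : K.AP F ↔ K.Amalgamation False F := by
  simp only [AP, Amalgamation, false_imp_iff, and_true, DFunLike.ext_iff, Embedding.comp_apply]

/-- The elementwise form of disjointness can be checked in a single factor of an ultraproduct. -/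
theorem dap_iff {F : Set Cardinal.{u}} : K.DAP F ↔ K.Amalgamation True F := by
  have key : ∀ {M₀ M₁ M₂ N : Type u} [L.Structure M₀] [L.Structure M₁] [L.Structure M₂]
      [L.Structure N] (f₁ : M₀ ↪[L] M₁) (f₂ : M₀ ↪[L] M₂) (g₁ : M₁ ↪[L] N) (g₂ : M₂ ↪[L] N),
      (g₁.comp f₁ = g₂.comp f₂ ∧ Set.range g₁ ∩ Set.range g₂ = Set.range (g₁.comp f₁)) ↔
      ((∀ m, g₁ (f₁ m) = g₂ (f₂ m)) ∧
        (True → ∀ m₁ m₂, g₁ m₁ = g₂ m₂ → ∃ m, f₁ m = m₁ ∧ f₂ m = m₂)) := by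
    intro M₀ M₁ M₂ N _ _ _ _ f₁ f₂ g₁ g₂
    simp only [DFunLike.ext_iff, Embedding.comp_apply, true_imp_iff]
    refine and_congr_right fun hc => ⟨fun h m₁ m₂ hm => ?_, fun h => ?_⟩
    · obtain ⟨m, hm'⟩ := h.subset ⟨⟨m₁, rfl⟩, ⟨m₂, hm.symm⟩⟩
      rw [Embedding.comp_apply] at hm'
      exact ⟨m, g₁.injective hm', g₂.injective (by rw [← hc, hm', hm])⟩
    · ext z
      constructor
      · rintro ⟨⟨m₁, rfl⟩, ⟨m₂, hm⟩⟩
        obtain ⟨m, rfl, -⟩ := h m₁ m₂ hm.symm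
        exact ⟨m, rfl⟩
      · rintro ⟨m, rfl⟩
        exact ⟨⟨f₁ m, rfl⟩, ⟨f₂ m, (hc m).symm⟩⟩
  simp only [DAP, Amalgamation, key]

/-- Amalgamation over small strong substructures that contain given small sets. -/
theorem Amalgamation.exists_local {d : Prop} {μ : Cardinal.{u}} (hκ : ℵ₀ < κ) (hLS : K.LS < κ)
    (hμ : μ < κ) (h : K.Amalgamation d (Set.Ico μ κ)) {M₀ M₁ M₂ : Type u} [L.Structure M₀]
    [L.Structure M₁] [L.Structure M₂] (hc₀ : μ ≤ #M₀) {f₁ : M₀ ↪[L] M₁} {f₂ : M₀ ↪[L] M₂}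
    (hf₁ : K.IsEmbedding f₁) (hf₂ : K.IsEmbedding f₂) {s₁ : Set M₁} {s₂ : Set M₂}
    (hs₁ : #s₁ < κ) (hs₂ : #s₂ < κ) :
    ∃ (P₁ : L.Substructure M₁) (P₂ : L.Substructure M₂) (N : Type u) (_ : L.Structure N)
      (g₁ : P₁ ↪[L] N) (g₂ : P₂ ↪[L] N), s₁ ⊆ P₁ ∧ s₂ ⊆ P₂ ∧ K.Strong P₁ ∧ K.Strong P₂ ∧
      K.IsEmbedding g₁ ∧ K.IsEmbedding g₂ ∧
      (∀ m, f₁ m ∈ s₁ → ∀ (h₁ : f₁ m ∈ P₁) (h₂ : f₂ m ∈ P₂), g₁ ⟨f₁ m, h₁⟩ = g₂ ⟨f₂ m, h₂⟩) ∧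
      (d → ∀ p₁ p₂, g₁ p₁ = g₂ p₂ → ∃ m, f₁ m = p₁ ∧ f₂ m = p₂) := by
  obtain ⟨p, hp⟩ := Cardinal.le_mk_iff_exists_set.1 hc₀
  -- `P₀` must absorb the preimage of `s₁`, where commutation is claimed, and `p`, which makes it of
  -- size at least `μ`. `P₁` and `P₂` inherit this lower bound by containing the images of `P₀`.
  obtain ⟨P₀, hP₀, hsP₀, hPc₀⟩ := exists_strong_of_card_lt hκ hLS hf₁.mem_left
    (card_union_lt hκ ((Cardinal.mk_preimage_of_injective _ s₁ f₁.injective).trans_lt hs₁)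
      (hp.trans_lt hμ))
  obtain ⟨P₁, hP₁, hsP₁, hPc₁⟩ := exists_strong_of_card_lt hκ hLS hf₁.mem_right
    (card_union_lt hκ hs₁ ((Cardinal.mk_image_le (f := f₁) (s := (P₀ : Set M₀))).trans_lt hPc₀))
  obtain ⟨P₂, hP₂, hsP₂, hPc₂⟩ := exists_strong_of_card_lt hκ hLS hf₂.mem_right
    (card_union_lt hκ hs₂ ((Cardinal.mk_image_le (f := f₂) (s := (P₀ : Set M₀))).trans_lt hPc₀))
  have hμ₀ : μ ≤ #P₀ :=
    hp.ge.trans (Cardinal.mk_le_mk_of_subset (Set.subset_union_right.trans hsP₀))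
  have hmaps₁ : ∀ m : P₀, f₁.domRestrict P₀ m ∈ P₁ := fun m => hsP₁ (Or.inr ⟨m, m.2, rfl⟩)
  have hmaps₂ : ∀ m : P₀, f₂.domRestrict P₀ m ∈ P₂ := fun m => hsP₂ (Or.inr ⟨m, m.2, rfl⟩)
  let e₁ := (f₁.domRestrict P₀).codRestrict P₁ hmaps₁
  let e₂ := (f₂.domRestrict P₀).codRestrict P₂ hmaps₂
  have he₁ : K.IsEmbedding e₁ := by
    refine (isEmbedding_subtype.2 hP₁).of_comp ?_
    rw [Embedding.subtype_comp_codRestrict]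
    exact hf₁.comp (isEmbedding_subtype.2 hP₀)
  have he₂ : K.IsEmbedding e₂ := by
    refine (isEmbedding_subtype.2 hP₂).of_comp ?_
    rw [Embedding.subtype_comp_codRestrict]
    exact hf₂.comp (isEmbedding_subtype.2 hP₀)
  obtain ⟨N, inst, g₁, g₂, hg₁, hg₂, hcomm, hdisj⟩ := h P₀ P₁ P₂ he₁.mem_left he₁.mem_right
    he₂.mem_right ⟨hμ₀, hPc₀⟩ ⟨hμ₀.trans (Cardinal.mk_le_of_injective e₁.injective), hPc₁⟩
    ⟨hμ₀.trans (Cardinal.mk_le_of_injective e₂.injective), hPc₂⟩ e₁ e₂ he₁ he₂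
  refine ⟨P₁, P₂, N, inst, g₁, g₂, Set.subset_union_left.trans hsP₁,
    Set.subset_union_left.trans hsP₂, hP₁, hP₂, hg₁, hg₂, fun m hm _ _ => ?_,
    fun hd p₁ p₂ hp => ?_⟩
  · exact hcomm ⟨m, hsP₀ (Or.inl hm)⟩
  · obtain ⟨m, rfl, rfl⟩ := hdisj hd p₁ p₂ hp
    exact ⟨m, rfl, rfl⟩

theorem Amalgamation.Ici {d : Prop} {μ : Cardinal.{u}} (hκ : IsStronglyCompact κ)
    (hLS : K.LS < κ) (hμ : μ < κ) (h : K.Amalgamation d (Set.Ico μ κ)) :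
    K.Amalgamation d (Set.Ici μ) := by
  intro M₀ M₁ M₂ _ _ _ hM₀ hM₁ hM₂ hc₀ hc₁ hc₂ f₁ f₂ hf₁ hf₂
  rcases isEmpty_or_nonempty (M₁ ⊕ M₂) with hE | hne
  · rw [isEmpty_sum] at hE
    have h0 := Cardinal.aleph0_pos.trans hκ.1
    have hlt₁ : #M₁ < κ := by rwa [Cardinal.mk_eq_zero_iff.2 hE.1]
    have hlt₂ : #M₂ < κ := by rwa [Cardinal.mk_eq_zero_iff.2 hE.2]
    exact h M₀ M₁ M₂ hM₀ hM₁ hM₂ ⟨hc₀, (Cardinal.mk_le_of_injective f₁.injective).trans_lt hlt₁⟩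
      ⟨hc₁, hlt₁⟩ ⟨hc₂, hlt₂⟩ f₁ f₂ hf₁ hf₂
  obtain ⟨x₀⟩ := hne
  obtain ⟨I, s, U, hs, hU, hfine⟩ := exists_fine_ultrafilter hκ (M₁ ⊕ M₂)
  have hs' : ∀ i, #(insert x₀ (s i) : Set (M₁ ⊕ M₂)) < κ := fun i =>
    Cardinal.mk_insert_le.trans_lt
      (Cardinal.add_lt_of_lt hκ.1.le (hs i) (Cardinal.one_lt_aleph0.trans hκ.1))
  choose P₁ P₂ N inst g₁ g₂ hsP₁ hsP₂ hP₁ hP₂ hg₁ hg₂ hcomm hdisj using fun i =>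
    h.exists_local hκ.1 hLS hμ hc₀ hf₁ hf₂
      ((Cardinal.mk_preimage_of_injective _ _ Sum.inl_injective).trans_lt (hs' i))
      ((Cardinal.mk_preimage_of_injective _ _ Sum.inr_injective).trans_lt (hs' i))
  have hne : ∀ i, Nonempty (N i) := fun i => by
    rcases x₀ with m | m
    · exact ⟨g₁ i ⟨m, hsP₁ i (Set.mem_insert _ _)⟩⟩
    · exact ⟨g₂ i ⟨m, hsP₂ i (Set.mem_insert _ _)⟩⟩
  obtain ⟨G₁, x₁, hG₁, hGx₁, hx₁⟩ := exists_isEmbedding_ultraproduct (U := U) hκ.1 hLS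
    (fun i => (hg₁ i).mem_right) hM₁ hP₁
    (fun m => (hfine (Sum.inl m)).mono fun i hi => hsP₁ i (Set.mem_insert_of_mem _ hi)) hg₁
  obtain ⟨G₂, x₂, hG₂, hGx₂, hx₂⟩ := exists_isEmbedding_ultraproduct (U := U) hκ.1 hLS
    (fun i => (hg₁ i).mem_right) hM₂ hP₂
    (fun m => (hfine (Sum.inr m)).mono fun i hi => hsP₂ i (Set.mem_insert_of_mem _ hi)) hg₂
  refine ⟨_, _, G₁, G₂, hG₁, hG₂, fun m => ?_, fun hd m₁ m₂ hm => ?_⟩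
  · rw [hGx₁, hGx₂, ultraMk_eq_iff]
    -- Fineness at `f₁ m` alone puts `m` into the local base model.
    filter_upwards [hx₁ (f₁ m), hx₂ (f₂ m), hfine (Sum.inl (f₁ m))] with i ⟨h₁, e₁⟩ ⟨h₂, e₂⟩ hm
    rw [← e₁, ← e₂]
    exact hcomm i m (Set.mem_insert_of_mem _ hm) h₁ h₂
  · rw [hGx₁, hGx₂, ultraMk_eq_iff] at hm
    -- One factor in which the representatives agree already yields the common preimage in `M₀`.
    obtain ⟨i, hi, ⟨h₁, e₁⟩, ⟨h₂, e₂⟩⟩ := (hm.and ((hx₁ m₁).and (hx₂ m₂))).exists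
    rw [← e₁, ← e₂] at hi
    exact hdisj i hd _ _ hi

end AEC

theorem mainTheorem2 {L : FirstOrder.Language.{u, u}} (K : AEC L) (κ μ : Cardinal.{u})
    (hκ : IsStronglyCompact κ) (hLS : K.LS < κ) (hμ : μ < κ) :
    (K.AP (Set.Ico μ κ) → K.AP (Set.Ici μ)) ∧
    (K.JEP (Set.Ico μ κ) → K.JEP (Set.Ici μ)) ∧
    (K.DAP (Set.Ico μ κ) → K.DAP (Set.Ici μ)) := by
  rw [AEC.ap_iff, AEC.ap_iff, AEC.dap_iff, AEC.dap_iff]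
  exact ⟨AEC.Amalgamation.Ici hκ hLS hμ, AEC.jep_Ici hκ hLS hμ, AEC.Amalgamation.Ici hκ hLS hμ⟩
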